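/- Let $M \equiv (\mathcal{Z}, r, p)$ be a Markov decision process with a finite nonempty state space $\mathcal{S}$, finite nonempty action sets $\mathcal{A}(s)$, state-action pairs $\mathcal{Z} = \{(s,a) : s \in \mathcal{S}, a \in \mathcal{A}(s)\}$, mean rewards $r : \mathcal{Z} \to \mathbb{R}$ and transition kernel $p : \mathcal{Z} \to \mathcal{P}(\mathcal{S})$. A policy is a map $\pi$ with $\pi(s) \in \mathcal{A}(s)$ for all $s \in \mathcal{S}$; write $\mathbb{E}^{\pi}_s$ for the expectation when the process starts at $S_1 = s$ and follows $\pi$, i.e., $S_{t+1} \sim p(S_t, \pi(S_t))$. Assume that $M$ is communicating, i.e., that its diameter $$\max_{s \ne s'} \min_{\pi} \mathbb{E}^{\pi}_s\big[\inf\{t \ge 1 : S_t = s'\}\big]$$ is finite. The gain and bias functions of a policy $\pi$ are $$g^\pi(s) := \lim_{T\to\infty} \mathbb{E}_s^\pi\Big[\frac1T \sum_{t=1}^T r(S_t,\pi(S_t))\Big], \qquad h^\pi(s) := \lim_{N \to \infty} \frac1N \sum_{T=1}^N \mathbb{E}^\pi_s\Big[\sum_{t=1}^T \big(r(S_t,\pi(S_t))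 - g^\pi(S_t)\big)\Big].$$ A policy $\pi$ is Bellman optimal if for all $s \in \mathcal{S}$ $$g^\pi(s) = \max_{a \in \mathcal{A}(s)} \sum_{x \in \mathcal{S}} p(x|s,a)\, g^\pi(x), \qquad g^\pi(s) + h^\pi(s) = \max_{a \in \mathcal{A}(s)} \Big\{ r(s,a) + \sum_{x \in \mathcal{S}} p(x|s,a)\, h^\pi(x) \Big\}.$$ A model is non-degenerate if it has exactly one Bellman optimal policy and this policy is unichain, i.e., the Markov chain that it induces on $\mathcal{S}$ has exactly one recurrent class. Let $(U(z))_{z \in \mathcal{Z}}$ be i.i.d. random variables of distribution $\mathrm{N}(0,1)$. Then the perturbed model $M_U := (\mathcal{Z}, r + U, p)$ is almost surely non-degenerate. -/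

import Mathlib

open MeasureTheory ProbabilityTheory Filter Topology

/-- A Markov decision process with finite state space `S`, action sets `A s`, state-action pairs
`(s : S) × A s`, mean rewards `r` and transition kernel `p`, where `p z x` is the probability of
moving to `x` when the pair `z` is played. The rewards enter the average-reward criteria only
through their means. -/
structure MDP (S : Type*) (A : S → Type*) [Fintype S] where
  r : ((s : S) × A s) → ℝ
  p : ((s : S) × A s) → S → ℝ
  p_nonneg : ∀ z x, 0 ≤ p z x
  p_sum : ∀ z, ∑ x, p z x = 1

namespace MDP

/-- Stationary deterministic policies. -/
abbrev Policy (S : Type*) (A : S → Type*) := (s : S) → A s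

section

variable {S : Type*} {A : S → Type*} [Fintype S]

/-- The model with the same kernel whose rewards are perturbed by `u`. -/
def addReward (M : MDP S A) (u : ((s : S) × A s) → ℝ) : MDP S A where
  r := M.r + u
  p := M.p
  p_nonneg := M.p_nonneg
  p_sum := M.p_sum

/-- The transition matrix of the Markov chain induced by a policy. -/
def transMatrix (M : MDP S A) (π : Policy S A) : Matrix S S ℝ :=
  Matrix.of fun x y => M.p ⟨x, π x⟩ y

/-- The reward function of a policy. -/
def polReward (M : MDP S A) (π : Policy S A) : S → ℝ := fun x => M.r ⟨x, π x⟩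

variable [DecidableEq S]

/-- `M.expect π f t s` is the expectation of `f (S_{t+1})` when the process starts at `S_1 = s` and
follows `π` (the law of `S_{t+1}` is the row `s` of the `t`-th power of the transition matrix). -/
def expect (M : MDP S A) (π : Policy S A) (f : S → ℝ) (t : ℕ) (s : S) : ℝ :=
  ∑ x, (M.transMatrix π ^ t) s x * f x

/-- `g` is the gain function of `π`: `g s` is the limit of `E_s[(1/T) ∑_{t=1}^T R_t]`. -/
def IsGain (M : MDP S A) (π : Policy S A) (g : S → ℝ) : Prop :=
  ∀ s, Tendsto (fun T : ℕ => (1 / (T : ℝ)) * ∑ t ∈ Finset.range T, M.expect π (M.polReward π) t s)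
    atTop (𝓝 (g s))

/-- `h` is the bias function of `π`, whose gain function is `g`: `h s` is the Cesàro limit, as
`T → ∞`, of `E_s[∑_{t=1}^T (R_t - g (S_t))]`. -/
def IsBias (M : MDP S A) (π : Policy S A) (g h : S → ℝ) : Prop :=
  ∀ s, Tendsto
    (fun N : ℕ => (1 / (N : ℝ)) * ∑ T ∈ Finset.Icc 1 N,
      ∑ t ∈ Finset.range T, M.expect π (M.polReward π - g) t s)
    atTop (𝓝 (h s))

/-- `π` is Bellman optimal: its gain and bias functions satisfy the first two orders of the
optimality equations (`IsGreatest` says that the left-hand side is the maximum over actions). -/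
def IsBellmanOptimal (M : MDP S A) (π : Policy S A) : Prop :=
  ∃ g h : S → ℝ, M.IsGain π g ∧ M.IsBias π g h ∧
    (∀ s, IsGreatest (Set.range fun a : A s => ∑ x, M.p ⟨s, a⟩ x * g x) (g s)) ∧
    (∀ s, IsGreatest (Set.range fun a : A s => M.r ⟨s, a⟩ + ∑ x, M.p ⟨s, a⟩ x * h x) (g s + h s))

/-- `y` is accessible from `x` under `π`: it is visited with positive probability. -/
def Accessible (M : MDP S A) (π : Policy S A) (x y : S) : Prop :=
  ∃ n : ℕ, 0 < (M.transMatrix π ^ n) x y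

/-- A recurrent class of (the finite Markov chain induced by) `π`: a nonempty set of states that is
closed (it cannot be left) and in which all states are accessible from each other. -/
def IsRecurrentClass (M : MDP S A) (π : Policy S A) (C : Set S) : Prop :=
  C.Nonempty ∧ (∀ x ∈ C, ∀ y, M.Accessible π x y → y ∈ C) ∧
    ∀ x ∈ C, ∀ y ∈ C, M.Accessible π x y

/-- A policy is unichain if it has exactly one recurrent class (the other states, if any, are
transient). -/
def IsUnichain (M : MDP S A) (π : Policy S A) : Prop :=
  ∃! C : Set S, M.IsRecurrentClass π C

/-- A model is non-degenerate if it has a unique Bellman optimal policy and this policy is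
unichain. -/
def NonDegenerate (M : MDP S A) : Prop :=
  ∃ π : Policy S A, M.IsBellmanOptimal π ∧ (∀ π' : Policy S A, M.IsBellmanOptimal π' → π' = π) ∧
    M.IsUnichain π

/-- `M.noVisit π y n x` is the probability that `S_1 ≠ y, …, S_n ≠ y` when the process starts at
`S_1 = x` and follows `π`. -/
def noVisit (M : MDP S A) (π : Policy S A) (y : S) : ℕ → S → ℝ
  | 0, _ => 1
  | n + 1, x => if x = y then 0 else ∑ z, M.transMatrix π x z * noVisit M π y n z

/-- The expectation `E_x[τ]` of `τ = inf {t ≥ 1 : S_t = y}` under `π`, in `[0, ∞]`, as the sum over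
`n ≥ 0` of the probabilities that `τ > n`. -/
noncomputable def expectedHittingTime (M : MDP S A) (π : Policy S A) (x y : S) : ENNReal :=
  ∑' n : ℕ, ENNReal.ofReal (M.noVisit π y n x)

/-- The diameter: the maximum over `x ≠ y` of the least expected time to go from `x` to `y`. -/
noncomputable def diameter (M : MDP S A) : ENNReal :=
  ⨆ (x : S) (y : S) (_ : x ≠ y), ⨅ π : Policy S A, M.expectedHittingTime π x y

/-- A model is communicating if its diameter is finite. -/
def Communicating (M : MDP S A) : Prop := M.diameter < ⊤

end

end MDP

/-! For a policy with transition matrix `P` and reward vector `r`, the gain is `Q r` and the bias is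
`H r`, where `Q` is the Cesàro limit of the powers of `P` and `H` the deviation matrix. Both depend
on the kernel alone, so gain and bias are linear in the rewards and each coincidence that could
cause degeneracy is an affine equation in `U`. If some coefficient of `U` is nonzero, the equation
almost surely fails (`ae_linearMap_gaussian_ne`), and there are finitely many equations.

Two families are excluded: an action outside the policy attaining equality in its evaluation
equation, and equal gains at two states where the rows of `Q` differ. A Bellman optimal gain is
superharmonic for every action, hence constant in a communicating model (`eq_of_superharmonic`), so
`Q` has equal rows and the policy is unichain (`isUnichain_of_rows_eq`). Strictness outside the
policy gives uniqueness (`isBellmanOptimal_unique`). Existence is by vanishing discount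
(`exists_isBellmanOptimal`). -/

namespace Matrix

/-! ### Cesàro limit and deviation matrix of a stochastic matrix. -/

variable {S : Type*} [Fintype S] [DecidableEq S] {P Q H K : Matrix S S ℝ}

lemma norm_mulVec_le_of_mem_rowStochastic (hP : P ∈ rowStochastic ℝ S) (v : S → ℝ) :
    ‖P *ᵥ v‖ ≤ ‖v‖ := by
  refine (pi_norm_le_iff_of_nonneg (norm_nonneg v)).2 fun x => ?_
  calc ‖(P *ᵥ v) x‖ ≤ ∑ y, ‖P x y * v y‖ := norm_sum_le _ _
    _ ≤ ∑ y, P x y * ‖v‖ := by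
        refine Finset.sum_le_sum fun y _ => ?_
        rw [norm_mul, Real.norm_of_nonneg (hP.1 x y)]
        exact mul_le_mul_of_nonneg_left (norm_le_pi_norm v y) (hP.1 x y)
    _ = ‖v‖ := by rw [← Finset.sum_mul, sum_row_of_mem_rowStochastic hP, one_mul]

/-- The vector `w = (1 - P) v` is fixed by `P`, so `T w` telescopes to `v - P ^ T v`, which is
bounded in `T`. Thus the eigenvalue one is semisimple. -/
lemma one_sub_mulVec_eq_zero_of_sq (hP : P ∈ rowStochastic ℝ S) {v : S → ℝ}
    (hv : (1 - P) *ᵥ ((1 - P) *ᵥ v) = 0) : (1 - P) *ᵥ v = 0 := by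
  set w := (1 - P) *ᵥ v with hw
  have hPw : P *ᵥ w = w := by
    rw [sub_mulVec, one_mulVec, sub_eq_zero] at hv
    exact hv.symm
  have hpow : ∀ t : ℕ, (P ^ t) *ᵥ w = w := by
    intro t
    induction t with
    | zero => simp
    | succ t ih => rw [pow_succ, ← mulVec_mulVec, hPw, ih]
  have hbound : ∀ T : ℕ, (T : ℝ) * ‖w‖ ≤ 2 * ‖v‖ := by
    intro T
    have h1 : (T : ℝ) • w = v - (P ^ T) *ᵥ v := by
      have h2 : (∑ t ∈ Finset.range T, P ^ t) *ᵥ w = (T : ℝ) • w := by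
        rw [sum_mulVec, Finset.sum_congr rfl fun t _ => hpow t, Finset.sum_const,
          Finset.card_range, Nat.cast_smul_eq_nsmul]
      rw [← h2, hw, mulVec_mulVec, geom_sum_mul_neg, sub_mulVec, one_mulVec]
    calc (T : ℝ) * ‖w‖ = ‖(T : ℝ) • w‖ := by rw [norm_smul]; simp
      _ ≤ ‖v‖ + ‖(P ^ T) *ᵥ v‖ := by rw [h1]; exact norm_sub_le _ _
      _ ≤ 2 * ‖v‖ := by
        linarith [norm_mulVec_le_of_mem_rowStochastic (pow_mem hP T) v]
  by_contra hne
  have hpos : 0 < ‖w‖ := norm_pos_iff.2 hne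
  obtain ⟨T, hT⟩ := exists_nat_gt (2 * ‖v‖ / ‖w‖)
  rw [div_lt_iff₀ hpos] at hT
  linarith [hbound T]

lemma one_sub_mul_eq_zero_of_sq (hP : P ∈ rowStochastic ℝ S) {X : Matrix S S ℝ}
    (hX : (1 - P) * ((1 - P) * X) = 0) : (1 - P) * X = 0 := by
  refine ext_of_mulVec_single fun i => ?_
  rw [← mulVec_mulVec, zero_mulVec]
  refine one_sub_mulVec_eq_zero_of_sq hP ?_
  rw [mulVec_mulVec, mulVec_mulVec, Matrix.mul_assoc, hX, zero_mulVec]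

/-- `Q` is the Cesàro limit of the powers of `P` (the projection onto the kernel of `1 - P` along
its range), and `H = (1 - P) * K` is the deviation matrix (the group inverse of `1 - P`). -/
structure IsDeviation (P Q H K : Matrix S S ℝ) : Prop where
  add_mul : Q + (1 - P) * H = 1
  eq_mul : H = (1 - P) * K
  mul_eq : P * Q = Q
  mul_eq' : Q * P = Q

/-- With `A = 1 - P`, semisimplicity gives `A ^ 3` the kernel of `A`, hence by rank-nullity its
range. So `A ^ 3 K = A` is solvable column by column, and `Q = 1 - A ^ 2 K`. -/
theorem exists_isDeviation (hP : P ∈ rowStochastic ℝ S) :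
    ∃ Q H K : Matrix S S ℝ, IsDeviation P Q H K := by
  set A := 1 - P with hA
  have hker : LinearMap.ker (A * (A * A)).mulVecLin = LinearMap.ker A.mulVecLin := by
    ext v
    simp only [LinearMap.mem_ker, mulVecLin_apply]
    constructor
    · intro h
      refine one_sub_mulVec_eq_zero_of_sq hP (one_sub_mulVec_eq_zero_of_sq hP ?_)
      rw [← hA, mulVec_mulVec, mulVec_mulVec, mul_assoc]
      exact h
    · intro h
      rw [← mul_assoc, ← mulVec_mulVec, h, mulVec_zero]
  have hrange : LinearMap.range (A * (A * A)).mulVecLin = LinearMap.range A.mulVecLin := by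
    refine Submodule.eq_of_le_of_finrank_eq ?_ ?_
    · rintro _ ⟨v, rfl⟩
      exact ⟨(A * A) *ᵥ v, by simp [mulVec_mulVec]⟩
    · have h1 := LinearMap.finrank_range_add_finrank_ker (A * (A * A)).mulVecLin
      have h2 := LinearMap.finrank_range_add_finrank_ker A.mulVecLin
      rw [hker] at h1
      omega
  have hk : ∀ j : S, ∃ k : S → ℝ, (A * (A * A)) *ᵥ k = A *ᵥ Pi.single j 1 := by
    intro j
    have : A *ᵥ Pi.single j 1 ∈ LinearMap.range (A * (A * A)).mulVecLin := by
      rw [hrange]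
      exact ⟨_, rfl⟩
    exact this
  choose k hk using hk
  set K : Matrix S S ℝ := Matrix.of fun i j => k j i
  have hK : A * (A * A) * K = A := by
    refine ext_of_mulVec_single fun j => ?_
    rw [← hk j, ← mulVec_mulVec]
    congr 1
    ext i
    simp [K]
  have hAQ : A * (1 - A * (A * K)) = 0 := by
    rw [mul_sub, mul_one, ← mul_assoc, ← mul_assoc, mul_assoc A A A, hK, sub_self]
  have hQA : (1 - A * (A * K)) * A = 0 := by
    have h : (1 - A * (A * K)) * A = A * (1 - A * K * A) := by noncomm_ring
    rw [h]
    -- The product `Q A` lies in the range of `A` and is annihilated by `A`, so semisimplicity kills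
    -- it.
    refine one_sub_mul_eq_zero_of_sq hP ?_
    rw [← hA, ← h, ← mul_assoc, hAQ, zero_mul]
  refine ⟨1 - A * (A * K), A * K, K, by rw [sub_add_cancel], rfl, ?_, ?_⟩
  · rw [hA, sub_mul, one_mul, sub_eq_zero, ← hA] at hAQ
    exact hAQ.symm
  · conv_lhs at hQA => rw [hA, mul_sub, mul_one, ← hA]
    exact (sub_eq_zero.1 hQA).symm

namespace IsDeviation

lemma pow_mul_eq (h : IsDeviation P Q H K) (t : ℕ) : P ^ t * Q = Q := by
  induction t with
  | zero => simp
  | succ t ih => rw [pow_succ, mul_assoc, h.mul_eq, ih]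

lemma geom_sum_eq (h : IsDeviation P Q H K) (T : ℕ) :
    ∑ t ∈ Finset.range T, P ^ t = (T : ℝ) • Q + (H - P ^ T * H) := by
  calc ∑ t ∈ Finset.range T, P ^ t
      = (∑ t ∈ Finset.range T, P ^ t) * (Q + (1 - P) * H) := by rw [h.add_mul, mul_one]
    _ = _ := by
      rw [mul_add, Finset.sum_mul, Finset.sum_congr rfl fun t _ => h.pow_mul_eq t,
        ← mul_assoc, geom_sum_mul_neg, sub_mul, one_mul, Finset.sum_const, Finset.card_range,
        Nat.cast_smul_eq_nsmul]

lemma geom_sum_mulVec (h : IsDeviation P Q H K) (T : ℕ) (r : S → ℝ) :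
    (∑ t ∈ Finset.range T, P ^ t) *ᵥ r =
      (T : ℝ) • (Q *ᵥ r) + (H *ᵥ r - (P ^ T) *ᵥ (H *ᵥ r)) := by
  rw [h.geom_sum_eq, add_mulVec, smul_mulVec, sub_mulVec, mulVec_mulVec]

lemma tendsto_inv_mul_of_bounded {u : ℕ → ℝ} (C : ℝ) (hu : ∀ n, |u n| ≤ C) :
    Tendsto (fun n : ℕ => (1 / (n : ℝ)) * u n) atTop (𝓝 0) := by
  refine squeeze_zero_norm (a := fun n : ℕ => (1 / (n : ℝ)) * C) (fun n => ?_) ?_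
  · rw [norm_mul, Real.norm_of_nonneg (by positivity)]
    exact mul_le_mul_of_nonneg_left (hu n) (by positivity)
  · simpa using tendsto_one_div_atTop_nhds_zero_nat.mul_const C

lemma tendsto_average (hP : P ∈ rowStochastic ℝ S) (h : IsDeviation P Q H K) (r : S → ℝ)
    (s : S) :
    Tendsto (fun T : ℕ => (1 / (T : ℝ)) * ∑ t ∈ Finset.range T, ((P ^ t) *ᵥ r) s) atTop
      (𝓝 ((Q *ᵥ r) s)) := by
  have h0 : Tendsto (fun T : ℕ => (Q *ᵥ r) s +
      (1 / (T : ℝ)) * ((H *ᵥ r) s - ((P ^ T) *ᵥ (H *ᵥ r)) s)) atTop (𝓝 ((Q *ᵥ r) s + 0)) := by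
    refine tendsto_const_nhds.add (tendsto_inv_mul_of_bounded (‖H *ᵥ r‖ + ‖H *ᵥ r‖) fun n => ?_)
    refine (abs_sub _ _).trans (add_le_add (norm_le_pi_norm (H *ᵥ r) s) ?_)
    exact (norm_le_pi_norm _ s).trans (norm_mulVec_le_of_mem_rowStochastic (pow_mem hP n) _)
  rw [add_zero] at h0
  refine h0.congr' ?_
  filter_upwards [eventually_gt_atTop 0] with T hT
  have hT' : (T : ℝ) ≠ 0 := by positivity
  have h1 := congrFun (h.geom_sum_mulVec T r) s
  rw [sum_mulVec, Finset.sum_apply] at h1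
  rw [h1]
  simp only [Pi.add_apply, Pi.smul_apply, Pi.sub_apply, smul_eq_mul]
  field_simp

lemma tendsto_average_apply (hP : P ∈ rowStochastic ℝ S) (h : IsDeviation P Q H K) (x y : S) :
    Tendsto (fun T : ℕ => (1 / (T : ℝ)) * ∑ t ∈ Finset.range T, (P ^ t) x y) atTop
      (𝓝 (Q x y)) := by
  simpa using h.tendsto_average hP (Pi.single y 1) x

lemma nonneg (hP : P ∈ rowStochastic ℝ S) (h : IsDeviation P Q H K) (x y : S) : 0 ≤ Q x y := by
  refine ge_of_tendsto' (h.tendsto_average_apply hP x y) fun T => ?_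
  exact mul_nonneg (by positivity) (Finset.sum_nonneg fun t _ => (pow_mem hP t).1 x y)

lemma mulVec_one (hP : P ∈ rowStochastic ℝ S) (h : IsDeviation P Q H K) : Q *ᵥ 1 = 1 := by
  ext x
  refine tendsto_nhds_unique (h.tendsto_average hP 1 x) ?_
  refine tendsto_const_nhds.congr' ?_
  filter_upwards [eventually_gt_atTop 0] with T hT
  have hT' : (T : ℝ) ≠ 0 := by positivity
  rw [Finset.sum_congr rfl fun t _ => congrFun (pow_mem hP t).2 x]
  simp [hT']

lemma mem_rowStochastic (hP : P ∈ rowStochastic ℝ S) (h : IsDeviation P Q H K) :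
    Q ∈ rowStochastic ℝ S := ⟨h.nonneg hP, h.mulVec_one hP⟩

lemma mul_pow_eq (h : IsDeviation P Q H K) (t : ℕ) : Q * P ^ t = Q := by
  induction t with
  | zero => simp
  | succ t ih => rw [pow_succ, ← mul_assoc, ih, h.mul_eq']

/-- Evaluation equation: `Q r + H r = r + P H r`. -/
lemma evaluation_eq (h : IsDeviation P Q H K) (r : S → ℝ) :
    Q *ᵥ r + H *ᵥ r = r + P *ᵥ (H *ᵥ r) := by
  have h1 := congrArg (· *ᵥ r) h.add_mul
  simp only [add_mulVec, ← mulVec_mulVec, sub_mulVec, one_mulVec] at h1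
  rw [← sub_eq_zero] at h1 ⊢
  rw [← h1]
  abel

lemma sum_pow_mulVec_sub (h : IsDeviation P Q H K) (T : ℕ) (r : S → ℝ) :
    ∑ t ∈ Finset.range T, (P ^ t) *ᵥ (r - Q *ᵥ r) = H *ᵥ r - (P ^ T) *ᵥ (H *ᵥ r) := by
  have h1 := h.geom_sum_mulVec T r
  rw [sum_mulVec] at h1
  simp only [mulVec_sub, Finset.sum_sub_distrib, h1, mulVec_mulVec, h.pow_mul_eq,
    Finset.sum_const, Finset.card_range, ← Nat.cast_smul_eq_nsmul ℝ]
  abel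

/-- Factoring `H` as `(1 - P) K` makes a second telescoping possible. The sums stay bounded, so the
Cesàro limit of the bias exists even for periodic chains. -/
lemma sum_pow_succ_mulVec (h : IsDeviation P Q H K) (N : ℕ) (r : S → ℝ) :
    ∑ T ∈ Finset.Icc 1 N, (P ^ T) *ᵥ (H *ᵥ r) = P *ᵥ (K *ᵥ r) - (P ^ (N + 1)) *ᵥ (K *ᵥ r) := by
  induction N with
  | zero => simp
  | succ N ih =>
    rw [Finset.sum_Icc_succ_top (by omega), ih, h.eq_mul, ← mulVec_mulVec, sub_mulVec, one_mulVec,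
      mulVec_sub, mulVec_mulVec _ (P ^ (N + 1)) P, ← pow_succ]
    abel

lemma tendsto_bias (hP : P ∈ rowStochastic ℝ S) (h : IsDeviation P Q H K) (r : S → ℝ) (s : S) :
    Tendsto (fun N : ℕ => (1 / (N : ℝ)) * ∑ T ∈ Finset.Icc 1 N,
      ∑ t ∈ Finset.range T, ((P ^ t) *ᵥ (r - Q *ᵥ r)) s) atTop (𝓝 ((H *ᵥ r) s)) := by
  have h0 : Tendsto (fun N : ℕ => (H *ᵥ r) s +
      (1 / (N : ℝ)) * (((P ^ (N + 1)) *ᵥ (K *ᵥ r)) s - (P *ᵥ (K *ᵥ r)) s)) atTop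
      (𝓝 ((H *ᵥ r) s + 0)) := by
    refine tendsto_const_nhds.add (tendsto_inv_mul_of_bounded (‖K *ᵥ r‖ + ‖K *ᵥ r‖) fun n => ?_)
    refine (abs_sub _ _).trans (add_le_add ?_ ?_)
    · exact (norm_le_pi_norm _ s).trans (norm_mulVec_le_of_mem_rowStochastic (pow_mem hP _) _)
    · exact (norm_le_pi_norm _ s).trans (norm_mulVec_le_of_mem_rowStochastic hP _)
  rw [add_zero] at h0
  refine h0.congr' ?_
  filter_upwards [eventually_gt_atTop 0] with N hN
  have hN' : (N : ℝ) ≠ 0 := by positivity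
  have h1 : ∑ T ∈ Finset.Icc 1 N, ∑ t ∈ Finset.range T, ((P ^ t) *ᵥ (r - Q *ᵥ r)) s =
      (∑ T ∈ Finset.Icc 1 N, (H *ᵥ r - (P ^ T) *ᵥ (H *ᵥ r))) s := by
    rw [Finset.sum_apply]
    refine Finset.sum_congr rfl fun T _ => ?_
    rw [← h.sum_pow_mulVec_sub, Finset.sum_apply]
  rw [h1, Finset.sum_sub_distrib, h.sum_pow_succ_mulVec]
  simp
  field_simp
  ring

/-- First terms of the Laurent expansion of discounted values at discount factor one. -/
lemma norm_discounted_sub_le (hP : P ∈ rowStochastic ℝ S) (h : IsDeviation P Q H K)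
    {r v : S → ℝ} {δ : ℝ} (hδ : 0 < δ) (hδ1 : δ < 1) (hv : v = r + (1 - δ) • (P *ᵥ v)) :
    ‖v - (1 / δ) • (Q *ᵥ r) - H *ᵥ r‖ ≤ 2 * ‖K *ᵥ r‖ * δ := by
  set k := K *ᵥ r with hk
  have hH : H *ᵥ r = k - P *ᵥ k := by
    rw [h.eq_mul, ← mulVec_mulVec, sub_mulVec, one_mulVec]
  have hPQ : P *ᵥ (Q *ᵥ r) = Q *ᵥ r := by rw [mulVec_mulVec, h.mul_eq]
  have hr := h.evaluation_eq r
  set g := Q *ᵥ r with hg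
  -- The correction `δ P k` lowers the residual in the discounted equation to order `δ ^ 2`; solving
  -- that equation costs a factor `1 / δ`.
  set e := v - (1 / δ) • g - H *ᵥ r + δ • (P *ᵥ k) with he
  have hee : e = (1 - δ) • (P *ᵥ e) + (δ ^ 2) • (P *ᵥ (P *ᵥ k)) := by
    rw [he]
    simp only [mulVec_add, mulVec_sub, mulVec_smul, hPQ]
    rw [hH] at hr ⊢
    simp only [mulVec_sub] at hr ⊢
    ext x
    have h1 := congrFun hr x
    have h2 := congrFun hv x
    simp only [Pi.add_apply, Pi.sub_apply, Pi.smul_apply, smul_eq_mul] at h1 h2 ⊢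
    field_simp
    linear_combination δ * h2 - δ * h1
  have hPk := norm_mulVec_le_of_mem_rowStochastic hP k
  have hbound : ‖e‖ ≤ (1 - δ) * ‖e‖ + δ ^ 2 * ‖k‖ := by
    calc ‖e‖ = ‖(1 - δ) • (P *ᵥ e) + (δ ^ 2) • (P *ᵥ (P *ᵥ k))‖ := by rw [← hee]
      _ ≤ ‖(1 - δ) • (P *ᵥ e)‖ + ‖(δ ^ 2) • (P *ᵥ (P *ᵥ k))‖ := norm_add_le _ _
      _ ≤ _ := by
        rw [norm_smul, norm_smul, Real.norm_of_nonneg (by linarith),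
          Real.norm_of_nonneg (by positivity)]
        exact add_le_add
          (mul_le_mul_of_nonneg_left (norm_mulVec_le_of_mem_rowStochastic hP e) (by linarith))
          (mul_le_mul_of_nonneg_left
            ((norm_mulVec_le_of_mem_rowStochastic hP _).trans hPk) (by positivity))
  have he' : ‖e‖ ≤ δ * ‖k‖ := by
    refine le_of_mul_le_mul_left ?_ hδ
    linarith
  have hsplit : v - (1 / δ) • g - H *ᵥ r = e - δ • (P *ᵥ k) := by rw [he]; abel
  rw [hsplit]
  calc ‖e - δ • (P *ᵥ k)‖ ≤ ‖e‖ + ‖δ • (P *ᵥ k)‖ := norm_sub_le _ _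
    _ ≤ δ * ‖k‖ + δ * ‖k‖ := by
      rw [norm_smul, Real.norm_of_nonneg hδ.le]
      exact add_le_add he' (mul_le_mul_of_nonneg_left hPk hδ.le)
    _ = _ := by ring

end IsDeviation

end Matrix

/-! ### Superharmonic vectors of a stochastic matrix. -/

namespace Matrix

variable {S : Type*} [Fintype S] [DecidableEq S] {P Q H K : Matrix S S ℝ}

lemma mulVec_mono_of_mem_rowStochastic (hP : P ∈ rowStochastic ℝ S) {v w : S → ℝ} (hvw : v ≤ w) :
    P *ᵥ v ≤ P *ᵥ w := fun x =>
  Finset.sum_le_sum fun y _ => mul_le_mul_of_nonneg_left (hvw y) (hP.1 x y)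

lemma pow_mulVec_le_of_mulVec_le (hP : P ∈ rowStochastic ℝ S) {v : S → ℝ} (hv : P *ᵥ v ≤ v)
    (t : ℕ) : (P ^ t) *ᵥ v ≤ v := by
  induction t with
  | zero => simp
  | succ t ih =>
    rw [pow_succ, ← mulVec_mulVec]
    exact (mulVec_mono_of_mem_rowStochastic (pow_mem hP t) hv).trans ih

lemma IsDeviation.mulVec_le_of_mulVec_le (hP : P ∈ rowStochastic ℝ S) (h : IsDeviation P Q H K)
    {v : S → ℝ} (hv : P *ᵥ v ≤ v) : Q *ᵥ v ≤ v := by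
  intro x
  refine le_of_tendsto (h.tendsto_average hP v x) ?_
  filter_upwards [eventually_gt_atTop 0] with T hT
  have hT' : (0 : ℝ) < T := by positivity
  rw [one_div, inv_mul_le_iff₀ hT']
  calc ∑ t ∈ Finset.range T, ((P ^ t) *ᵥ v) x ≤ ∑ _t ∈ Finset.range T, v x :=
        Finset.sum_le_sum fun t _ => pow_mulVec_le_of_mulVec_le hP hv t x
    _ = T * v x := by simp

end Matrix

/-! ### Communicating models and the matrix form of Bellman optimality. -/

namespace MDP

open Matrix

section

variable {S : Type*} {A : S → Type*} [Fintype S] [DecidableEq S]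

lemma transMatrix_mem_rowStochastic (M : MDP S A) (π : Policy S A) :
    M.transMatrix π ∈ rowStochastic ℝ S :=
  mem_rowStochastic_iff_sum.2 ⟨fun _ _ => M.p_nonneg _ _, fun _ => M.p_sum _⟩

lemma Accessible.refl (M : MDP S A) (π : Policy S A) (x : S) : M.Accessible π x x :=
  ⟨0, by simp⟩

lemma Accessible.trans {M : MDP S A} {π : Policy S A} {x y z : S} (hxy : M.Accessible π x y)
    (hyz : M.Accessible π y z) : M.Accessible π x z := by
  obtain ⟨m, hm⟩ := hxy
  obtain ⟨n, hn⟩ := hyz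
  refine ⟨m + n, ?_⟩
  have hP := M.transMatrix_mem_rowStochastic π
  rw [pow_add, mul_apply]
  exact (mul_pos hm hn).trans_le (Finset.single_le_sum
    (f := fun w => (M.transMatrix π ^ m) x w * (M.transMatrix π ^ n) w z)
    (fun w _ => mul_nonneg ((pow_mem hP m).1 x w) ((pow_mem hP n).1 w z)) (Finset.mem_univ y))

lemma noVisit_eq_one_of_not_accessible (M : MDP S A) (π : Policy S A) (y : S) (n : ℕ) (x : S)
    (h : ¬ M.Accessible π x y) : M.noVisit π y n x = 1 := by
  induction n generalizing x with
  | zero => rfl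
  | succ n ih =>
    have hxy : x ≠ y := fun hxy => h (hxy ▸ Accessible.refl M π x)
    rw [noVisit, if_neg hxy, ← sum_row_of_mem_rowStochastic (M.transMatrix_mem_rowStochastic π) x]
    refine Finset.sum_congr rfl fun z _ => ?_
    rcases (M.p_nonneg ⟨x, π x⟩ z).eq_or_lt with h0 | hpos
    · have : M.transMatrix π x z = 0 := h0.symm
      rw [this, zero_mul]
    · have hxz : M.Accessible π x z := ⟨1, by simpa [transMatrix] using hpos⟩
      rw [ih z fun hz => h (hxz.trans hz), mul_one]

lemma Communicating.exists_accessible [∀ s, Nonempty (A s)] {M : MDP S A} (hM : M.Communicating)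
    (x y : S) : ∃ π : Policy S A, M.Accessible π x y := by
  by_contra! hno
  rcases eq_or_ne x y with rfl | hxy
  · exact hno (fun s => Classical.arbitrary _) (Accessible.refl M _ x)
  · have htop : ∀ π : Policy S A, M.expectedHittingTime π x y = ⊤ := by
      intro π
      simp only [expectedHittingTime, M.noVisit_eq_one_of_not_accessible π y _ x (hno π),
        ENNReal.ofReal_one]
      exact ENNReal.tsum_const_eq_top_of_ne_zero one_ne_zero
    have hle : (⊤ : ENNReal) ≤ M.diameter := by
      refine le_trans ?_ (le_iSup_of_le x (le_iSup_of_le y (le_iSup_of_le hxy le_rfl)))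
      simp [htop]
    exact absurd (lt_of_le_of_lt hle hM) (lt_irrefl _)

/-- Minimum principle: from a minimizer of `g`, some policy reaches `y` with positive probability,
and the mean of `g` after those steps does not exceed the minimum, so `g y` is minimal too. -/
lemma eq_of_superharmonic {M : MDP S A}
    (hacc : ∀ x y, ∃ π : Policy S A, M.Accessible π x y) {g : S → ℝ}
    (hg : ∀ s (a : A s), ∑ x, M.p ⟨s, a⟩ x * g x ≤ g s) (x y : S) : g x = g y := by
  have : Nonempty S := ⟨x⟩
  obtain ⟨x₀, hx₀⟩ := Finite.exists_min g
  suffices h : ∀ y, g y = g x₀ by rw [h x, h y]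
  intro y
  obtain ⟨π, n, hn⟩ := hacc x₀ y
  have hP := M.transMatrix_mem_rowStochastic π
  have hPn := pow_mem hP n
  have h1 : ((M.transMatrix π ^ n) *ᵥ g) x₀ ≤ g x₀ :=
    pow_mulVec_le_of_mulVec_le hP (fun s => hg s (π s)) n x₀
  have h2 : ∑ z, (M.transMatrix π ^ n) x₀ z * (g z - g x₀) ≤ 0 := by
    simp only [mul_sub, Finset.sum_sub_distrib, ← Finset.sum_mul,
      sum_row_of_mem_rowStochastic hPn x₀, one_mul]
    exact sub_nonpos.2 h1
  have h3 : (M.transMatrix π ^ n) x₀ y * (g y - g x₀) ≤ 0 :=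
    (Finset.single_le_sum (f := fun z => (M.transMatrix π ^ n) x₀ z * (g z - g x₀))
      (fun z _ => mul_nonneg (hPn.1 x₀ z) (sub_nonneg.2 (hx₀ z))) (Finset.mem_univ y)).trans h2
  have h4 : g y - g x₀ ≤ 0 := nonpos_of_mul_nonpos_right h3 hn
  exact le_antisymm (sub_nonpos.1 h4) (hx₀ y)

/-- The policy's own actions attain both maxima, by `P Q = Q` and the evaluation equation, so only
the inequalities carry information. -/
lemma isBellmanOptimal_iff (M : MDP S A) (π : Policy S A) {Q H K : Matrix S S ℝ}
    (hd : IsDeviation (M.transMatrix π) Q H K) :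
    M.IsBellmanOptimal π ↔
      (∀ s (a : A s), ∑ x, M.p ⟨s, a⟩ x * (Q *ᵥ M.polReward π) x ≤ (Q *ᵥ M.polReward π) s) ∧
      ∀ s (a : A s), M.r ⟨s, a⟩ + ∑ x, M.p ⟨s, a⟩ x * (H *ᵥ M.polReward π) x ≤
        (Q *ᵥ M.polReward π) s + (H *ᵥ M.polReward π) s := by
  have hP := M.transMatrix_mem_rowStochastic π
  have hgain : M.IsGain π (Q *ᵥ M.polReward π) := fun s => hd.tendsto_average hP _ s
  have hbias : M.IsBias π (Q *ᵥ M.polReward π) (H *ᵥ M.polReward π) :=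
    fun s => hd.tendsto_bias hP _ s
  constructor
  · rintro ⟨g, h, hg, hh, h1, h2⟩
    obtain rfl : g = Q *ᵥ M.polReward π := funext fun s => tendsto_nhds_unique (hg s) (hgain s)
    obtain rfl : h = H *ᵥ M.polReward π := funext fun s => tendsto_nhds_unique (hh s) (hbias s)
    exact ⟨fun s a => (h1 s).2 ⟨a, rfl⟩, fun s a => (h2 s).2 ⟨a, rfl⟩⟩
  · rintro ⟨h1, h2⟩
    refine ⟨_, _, hgain, hbias, fun s => ⟨⟨π s, ?_⟩, ?_⟩, fun s => ⟨⟨π s, ?_⟩, ?_⟩⟩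
    · have h := congrFun (congrArg (· *ᵥ M.polReward π) hd.mul_eq) s
      simp only [← mulVec_mulVec] at h
      exact h
    · rintro _ ⟨a, rfl⟩
      exact h1 s a
    · exact (congrFun (hd.evaluation_eq (M.polReward π)) s).symm
    · rintro _ ⟨a, rfl⟩
      exact h2 s a

end

/-! ### Existence of a Bellman optimal policy by vanishing discount. -/

section

variable {S : Type*} {A : S → Type*} [Fintype S] [∀ s, Fintype (A s)] [∀ s, Nonempty (A s)]


/-- Discounted optimality equation with discount factor `1 - δ`. -/
def IsDiscountedOptimal (M : MDP S A) (δ : ℝ) (π : Policy S A) (v : S → ℝ) : Prop :=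
  v = M.polReward π + (1 - δ) • (M.transMatrix π *ᵥ v) ∧
    ∀ s (a : A s), M.r ⟨s, a⟩ + (1 - δ) * ∑ x, M.p ⟨s, a⟩ x * v x ≤ v s

/-- The discounted Bellman operator contracts the sup norm by `1 - δ`; a policy greedy at its fixed
point works. -/
lemma exists_isDiscountedOptimal (M : MDP S A) {δ : ℝ} (hδ : 0 < δ) (hδ1 : δ < 1) :
    ∃ (π : Policy S A) (v : S → ℝ), M.IsDiscountedOptimal δ π v := by
  let F : (S → ℝ) → (s : S) → A s → ℝ := fun v s a =>
    M.r ⟨s, a⟩ + (1 - δ) * ∑ x, M.p ⟨s, a⟩ x * v x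
  let T : (S → ℝ) → S → ℝ := fun v s =>
    Finset.univ.sup' Finset.univ_nonempty (F v s)
  have hF : ∀ v w s a, F v s a ≤ F w s a + (1 - δ) * dist v w := by
    intro v w s a
    have h1 : ∑ x, M.p ⟨s, a⟩ x * v x ≤ ∑ x, M.p ⟨s, a⟩ x * (w x + dist v w) := by
      refine Finset.sum_le_sum fun x _ => mul_le_mul_of_nonneg_left ?_ (M.p_nonneg _ _)
      have h2 := (le_abs_self (v x - w x)).trans (dist_le_pi_dist v w x)
      linarith
    simp only [mul_add, Finset.sum_add_distrib, ← Finset.sum_mul, M.p_sum, one_mul] at h1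
    have h2 := mul_le_mul_of_nonneg_left h1 (sub_nonneg.2 hδ1.le)
    simp only [F]
    linarith
  have hT : ∀ v w s, T v s ≤ T w s + (1 - δ) * dist v w := fun v w s =>
    Finset.sup'_le _ _ fun a ha =>
      (hF v w s a).trans (add_le_add_left (Finset.le_sup' (F w s) ha) _)
  have hcontr : ContractingWith (Real.toNNReal (1 - δ)) T := by
    refine ⟨by rw [← NNReal.coe_lt_coe, Real.coe_toNNReal _ (by linarith)]; simpa using hδ,
      LipschitzWith.of_dist_le_mul fun v w => ?_⟩
    rw [Real.coe_toNNReal _ (by linarith)]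
    refine (dist_pi_le_iff (mul_nonneg (by linarith) dist_nonneg)).2 fun s => ?_
    rw [Real.dist_eq, abs_sub_le_iff]
    have h1 := hT v w s
    have h2 := hT w v s
    rw [dist_comm w v] at h2
    constructor <;> linarith
  have hfix : T (hcontr.fixedPoint T) = hcontr.fixedPoint T := hcontr.fixedPoint_isFixedPt
  set v := hcontr.fixedPoint T
  have hmax : ∀ s, ∃ a : A s, T v s = F v s a := fun s => by
    obtain ⟨a, -, ha⟩ := Finset.exists_mem_eq_sup' Finset.univ_nonempty (F v s)
    exact ⟨a, ha⟩
  choose π hπ using hmax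
  refine ⟨π, v, funext fun s => ?_, fun s a => ?_⟩
  · rw [← congrFun hfix s, hπ s]
    rfl
  · rw [← congrFun hfix s]
    exact Finset.le_sup' (F v s) (Finset.mem_univ a)

/-- Some policy is discounted optimal for discount factors arbitrarily close to one. -/
lemma exists_frequently_isDiscountedOptimal (M : MDP S A) :
    ∃ π : Policy S A, ∀ η > 0, ∃ δ, 0 < δ ∧ δ < η ∧ δ < 1 ∧
      ∃ v : S → ℝ, M.IsDiscountedOptimal δ π v := by
  by_contra! hno
  choose η hη hno using hno
  have : Nonempty (Policy S A) := ⟨fun s => Classical.arbitrary _⟩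
  obtain ⟨π₀, hπ₀⟩ := Finite.exists_min η
  have hpos : 0 < min (η π₀) 1 := lt_min (hη π₀) one_pos
  obtain ⟨π, v, hv⟩ := M.exists_isDiscountedOptimal (half_pos hpos)
    (by linarith [min_le_right (η π₀) 1])
  exact hno π (min (η π₀) 1 / 2) (half_pos hpos)
    (by linarith [min_le_left (η π₀) 1, hπ₀ π]) (by linarith [min_le_right (η π₀) 1]) v hv

lemma le_of_frequently_le_add_mul {a b C : ℝ} (h : ∀ η > 0, ∃ δ, 0 < δ ∧ δ < η ∧ b ≤ a + δ * C) :
    b ≤ a := by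
  by_contra! hab
  obtain ⟨δ, hδ, hlt, hle⟩ := h ((b - a) / (|C| + 1)) (div_pos (sub_pos.2 hab) (by positivity))
  rw [lt_div_iff₀ (by positivity)] at hlt
  nlinarith [le_abs_self C]

variable [DecidableEq S]

/-- A communicating model has a Bellman optimal policy. -/
theorem exists_isBellmanOptimal {M : MDP S A}
    (hacc : ∀ x y, ∃ π : Policy S A, M.Accessible π x y) :
    ∃ π : Policy S A, M.IsBellmanOptimal π := by
  obtain ⟨π, hπ⟩ := M.exists_frequently_isDiscountedOptimal
  refine ⟨π, ?_⟩
  have hP := M.transMatrix_mem_rowStochastic π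
  obtain ⟨Q, H, K, hd⟩ := exists_isDeviation hP
  rw [M.isBellmanOptimal_iff π hd]
  set g := Q *ᵥ M.polReward π
  set h := H *ᵥ M.polReward π
  set B := 2 * ‖K *ᵥ M.polReward π‖
  -- The discounted optimality inequality with `v` replaced by its Laurent expansion, up to an error
  -- `B δ`.
  have key : ∀ η > 0, ∃ δ, 0 < δ ∧ δ < η ∧ δ < 1 ∧ ∀ s (a : A s),
      M.r ⟨s, a⟩ + (1 - δ) * (∑ x, M.p ⟨s, a⟩ x * (g x / δ + h x) - B * δ) ≤
        g s / δ + h s + B * δ := by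
    intro η hη
    obtain ⟨δ, hδ, hδη, hδ1, v, hv, hopt⟩ := hπ η hη
    refine ⟨δ, hδ, hδη, hδ1, fun s a => ?_⟩
    have hnorm := hd.norm_discounted_sub_le hP hδ hδ1 hv
    have habs : ∀ x, |v x - (g x / δ + h x)| ≤ B * δ := by
      intro x
      have h1 := (norm_le_pi_norm _ x).trans hnorm
      simp only [Pi.sub_apply, Pi.smul_apply, smul_eq_mul, Real.norm_eq_abs] at h1
      have h2 : v x - (g x / δ + h x) = v x - 1 / δ * g x - h x := by ring
      rwa [h2]
    have h2 : ∑ x, M.p ⟨s, a⟩ x * (g x / δ + h x) - B * δ ≤ ∑ x, M.p ⟨s, a⟩ x * v x := by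
      have h3 : ∑ x, M.p ⟨s, a⟩ x * (g x / δ + h x - B * δ) ≤ ∑ x, M.p ⟨s, a⟩ x * v x := by
        refine Finset.sum_le_sum fun x _ => mul_le_mul_of_nonneg_left ?_ (M.p_nonneg _ _)
        linarith [(abs_le.1 (habs x)).1]
      simpa only [mul_sub, Finset.sum_sub_distrib, ← Finset.sum_mul, M.p_sum, one_mul] using h3
    have h4 := mul_le_mul_of_nonneg_left h2 (sub_nonneg.2 hδ1.le)
    linarith [hopt s a, (abs_le.1 (habs s)).2]
  have hB : 0 ≤ B := by positivity
  -- Compare the terms of order `1 / δ`: multiply by `δ` and bound the rest by `δ` times a constant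
  -- independent of `δ`.
  have hg : ∀ s (a : A s), ∑ x, M.p ⟨s, a⟩ x * g x ≤ g s := by
    intro s a
    set G := ∑ x, M.p ⟨s, a⟩ x * g x with hG
    set L := ∑ x, M.p ⟨s, a⟩ x * h x with hL
    refine le_of_frequently_le_add_mul
      (C := |h s| + B + |M.r ⟨s, a⟩| + |G| + |L| + B) fun η hη => ?_
    obtain ⟨δ, hδ, hδη, hδ1, hle⟩ := key η hη
    refine ⟨δ, hδ, hδη, ?_⟩
    have hsum : ∑ x, M.p ⟨s, a⟩ x * (g x / δ + h x) = G / δ + L := by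
      rw [hG, hL, Finset.sum_div, ← Finset.sum_add_distrib]
      exact Finset.sum_congr rfl fun x _ => by ring
    have h1 := mul_le_mul_of_nonneg_left (hle s a) hδ.le
    rw [hsum] at h1
    have e1 : δ * (M.r ⟨s, a⟩ + (1 - δ) * (G / δ + L - B * δ)) =
        G + δ * (M.r ⟨s, a⟩ - G + (1 - δ) * L - (1 - δ) * (B * δ)) := by
      field_simp
      ring
    have e2 : δ * (g s / δ + h s + B * δ) = g s + δ * (h s + B * δ) := by
      field_simp
      ring
    rw [e1, e2] at h1
    have h2 : h s + B * δ - (M.r ⟨s, a⟩ - G + (1 - δ) * L - (1 - δ) * (B * δ)) ≤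
        |h s| + B + |M.r ⟨s, a⟩| + |G| + |L| + B := by
      have i1 : B * δ ≤ B := mul_le_of_le_one_right hB hδ1.le
      have i2 : (1 - δ) * (B * δ) ≤ B :=
        (mul_le_of_le_one_left (by positivity) (by linarith)).trans i1
      have i3 : -((1 - δ) * L) ≤ |L| := by
        refine (neg_le_abs _).trans ?_
        rw [abs_mul, abs_of_pos (by linarith : 0 < 1 - δ)]
        exact mul_le_of_le_one_left (abs_nonneg L) (by linarith)
      linarith [le_abs_self (h s), neg_le_abs (M.r ⟨s, a⟩), le_abs_self G]
    have h3 := mul_le_mul_of_nonneg_left h2 hδ.le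
    linarith
  refine ⟨hg, fun s a => ?_⟩
  set L := ∑ x, M.p ⟨s, a⟩ x * h x with hL
  refine le_of_frequently_le_add_mul (C := |L| + B + B) fun η hη => ?_
  obtain ⟨δ, hδ, hδη, hδ1, hle⟩ := key η hη
  refine ⟨δ, hδ, hδη, ?_⟩
  -- The gain is now constant, so the terms of order `1 / δ` cancel and those of order zero decide.
  have hsum : ∑ x, M.p ⟨s, a⟩ x * (g x / δ + h x) = g s / δ + L := by
    simp only [fun x => eq_of_superharmonic hacc hg x s, mul_add, Finset.sum_add_distrib,
      ← Finset.sum_mul, M.p_sum, one_mul, hL]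
  have h1 := hle s a
  rw [hsum] at h1
  have e1 : (1 - δ) * (g s / δ + L - B * δ) =
      g s / δ - g s + L - δ * L - (1 - δ) * (B * δ) := by
    field_simp
    ring
  rw [e1] at h1
  have i1 : (1 - δ) * (B * δ) ≤ B * δ := mul_le_of_le_one_left (by positivity) (by linarith)
  have i2 : δ * L ≤ δ * |L| := mul_le_mul_of_nonneg_left (le_abs_self L) hδ.le
  linarith

end

end MDP

/-! ### Unichain structure and uniqueness. -/

namespace MDP

open Matrix

section

variable {S : Type*} {A : S → Type*} [Fintype S] [DecidableEq S]

/-- The unique class is `{y | 0 < Q y y}`: equal rows give `Q x y = Q y y`, so its states are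
accessible from everywhere. -/
lemma isUnichain_of_rows_eq [Nonempty S] (M : MDP S A) (π : Policy S A) {Q H K : Matrix S S ℝ}
    (hd : IsDeviation (M.transMatrix π) Q H K) (hQ : ∀ x y z, Q x z = Q y z) :
    M.IsUnichain π := by
  have hP := M.transMatrix_mem_rowStochastic π
  have hacc : ∀ x y, 0 < Q y y → M.Accessible π x y := by
    intro x y hy
    by_contra hno
    have h0 : ∀ t : ℕ, (M.transMatrix π ^ t) x y = 0 := fun t =>
      le_antisymm (not_lt.1 fun ht => hno ⟨t, ht⟩) ((pow_mem hP t).1 x y)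
    have hlim := hd.tendsto_average_apply hP x y
    simp only [h0, Finset.sum_const_zero, mul_zero] at hlim
    have hQ0 : Q x y = 0 := tendsto_nhds_unique hlim tendsto_const_nhds
    rw [hQ x y y] at hQ0
    exact hy.ne' hQ0
  have hclosed : ∀ x, 0 < Q x x → ∀ y, M.Accessible π x y → 0 < Q y y := by
    rintro x hx y ⟨n, hn⟩
    rw [hQ y x y, ← hd.mul_pow_eq n, mul_apply]
    exact (mul_pos hx hn).trans_le (Finset.single_le_sum
      (f := fun w => Q x w * (M.transMatrix π ^ n) w y)
      (fun w _ => mul_nonneg (hd.nonneg hP x w) ((pow_mem hP n).1 w y)) (Finset.mem_univ x))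
  have hne : ∃ y, 0 < Q y y := by
    by_contra! hno
    obtain ⟨x⟩ := ‹Nonempty S›
    have hsum := sum_row_of_mem_rowStochastic (hd.mem_rowStochastic hP) x
    have : ∑ y, Q x y ≤ 0 := Finset.sum_nonpos fun y _ => hQ x y y ▸ hno y
    linarith
  refine ⟨{y | 0 < Q y y}, ⟨hne, hclosed, fun x _ y hy => hacc x y hy⟩, ?_⟩
  rintro C ⟨⟨x, hx⟩, hCclosed, hCacc⟩
  have hsub : {y | 0 < Q y y} ⊆ C := fun y hy => hCclosed x hx y (hacc x y hy)
  obtain ⟨y, hy⟩ := hne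
  exact Set.Subset.antisymm (fun z hz => hclosed y hy z (hCacc y (hsub hy) z hz)) hsub

/-- Uniqueness of the Bellman optimal policy when no action outside a policy is tight in its
evaluation equation. -/
lemma isBellmanOptimal_unique [Nonempty S] {M : MDP S A}
    (hacc : ∀ x y, ∃ π : Policy S A, M.Accessible π x y) {π π' : Policy S A}
    {Q H K Q' H' K' : Matrix S S ℝ}
    (hd : IsDeviation (M.transMatrix π) Q H K) (hd' : IsDeviation (M.transMatrix π') Q' H' K')
    (hstrict : ∀ s (a : A s), a ≠ π s → (Q *ᵥ M.polReward π) s + (H *ᵥ M.polReward π) s ≠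
      M.r ⟨s, a⟩ + ∑ x, M.p ⟨s, a⟩ x * (H *ᵥ M.polReward π) x)
    (hQ : ∀ x y z, Q x z = Q y z)
    (hπ : M.IsBellmanOptimal π) (hπ' : M.IsBellmanOptimal π') : π' = π := by
  have hP := M.transMatrix_mem_rowStochastic π
  have hP' := M.transMatrix_mem_rowStochastic π'
  obtain ⟨s₀⟩ := ‹Nonempty S›
  rw [M.isBellmanOptimal_iff π hd] at hπ
  rw [M.isBellmanOptimal_iff π' hd'] at hπ'
  have hr := hd.evaluation_eq (M.polReward π)
  have hr' := hd'.evaluation_eq (M.polReward π')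
  set g := Q *ᵥ M.polReward π with hg
  set h := H *ᵥ M.polReward π
  set g' := Q' *ᵥ M.polReward π' with hg'
  set h' := H' *ᵥ M.polReward π'
  have hgc := eq_of_superharmonic hacc hπ.1
  have hgc' := eq_of_superharmonic hacc hπ'.1
  have hQg : Q' *ᵥ g = g := by
    ext x
    have : g = g x • (1 : S → ℝ) := funext fun y => by simp [hgc y x]
    rw [this, mulVec_smul, hd'.mulVec_one hP']
  have hQg' : Q *ᵥ g' = g' := by
    ext x
    have : g' = g' x • (1 : S → ℝ) := funext fun y => by simp [hgc' y x]
    rw [this, mulVec_smul, hd.mulVec_one hP]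
  have hle : M.polReward π' + M.transMatrix π' *ᵥ h ≤ g + h := fun s => hπ.2 s (π' s)
  have hle' : M.polReward π + M.transMatrix π *ᵥ h' ≤ g' + h' := fun s => hπ'.2 s (π s)
  -- Averaging each policy's optimality inequality along the other's stationary matrix cancels the
  -- bias and compares the gains.
  have hgg : g = g' := by
    refine le_antisymm ?_ ?_
    · have := mulVec_mono_of_mem_rowStochastic (hd.mem_rowStochastic hP) hle'
      simpa only [mulVec_add, mulVec_mulVec, hd.mul_eq', hQg', add_le_add_iff_right] using this
    · have := mulVec_mono_of_mem_rowStochastic (hd'.mem_rowStochastic hP') hle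
      simpa only [mulVec_add, mulVec_mulVec, hd'.mul_eq', hQg, add_le_add_iff_right] using this
  set d := h - h' with hd0
  have hgap : g + h - (M.polReward π' + M.transMatrix π' *ᵥ h) =
      d - M.transMatrix π' *ᵥ d := by
    have : M.polReward π' = g + h' - M.transMatrix π' *ᵥ h' := by rw [hgg, hr']; abel
    rw [this, hd0, mulVec_sub]
    abel
  have hgap' : g' + h' - (M.polReward π + M.transMatrix π *ᵥ h') =
      M.transMatrix π *ᵥ d - d := by
    have : M.polReward π = g' + h - M.transMatrix π *ᵥ h := by rw [← hgg, hr]; abel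
    rw [this, hd0, mulVec_sub]
    abel
  have htight : ∀ s, (d - M.transMatrix π' *ᵥ d) s = 0 → π' s = π s := by
    intro s hs
    by_contra hne
    refine hstrict s (π' s) hne ?_
    rw [← hgap] at hs
    exact sub_eq_zero.1 hs
  have hnonneg : 0 ≤ d - M.transMatrix π' *ᵥ d := hgap ▸ sub_nonneg.2 hle
  have hd1 : Q' *ᵥ d ≤ d := hd'.mulVec_le_of_mulVec_le hP' (sub_nonneg.1 hnonneg)
  have hd2 : Q *ᵥ (-d) ≤ -d := by
    refine hd.mulVec_le_of_mulVec_le hP ?_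
    rw [mulVec_neg, neg_le_neg_iff]
    exact sub_nonneg.1 (hgap' ▸ sub_nonneg.2 hle')
  -- The nonnegative gap `d - P' d` has zero `Q'`-average, so it vanishes on the support of `Q'`,
  -- where strictness forces the policies to agree.
  rw [mulVec_neg, neg_le_neg_iff] at hd2
  have hsupp : ∀ x y, Q' x y ≠ 0 → π' y = π y := by
    intro x y hxy
    refine htight y ?_
    have h0 : (Q' *ᵥ (d - M.transMatrix π' *ᵥ d)) x = 0 := by
      rw [mulVec_sub, mulVec_mulVec, hd'.mul_eq', sub_self, Pi.zero_apply]
    have h1 := (Finset.sum_eq_zero_iff_of_nonneg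
      (fun z _ => mul_nonneg (hd'.nonneg hP' x z) (hnonneg z))).1 h0 y (Finset.mem_univ y)
    exact (mul_eq_zero.1 h1).resolve_left hxy
  have hQP : Q' * M.transMatrix π = Q' := by
    conv_rhs => rw [← hd'.mul_eq']
    ext x z
    rw [mul_apply, mul_apply]
    refine Finset.sum_congr rfl fun y _ => ?_
    by_cases hxy : Q' x y = 0
    · rw [hxy, zero_mul, zero_mul]
    · simp only [transMatrix, of_apply, hsupp x y hxy]
  have hQQ : Q' * Q = Q' := by
    have h1 : Q' * (Q + (1 - M.transMatrix π) * H) = Q' := by rw [hd.add_mul, mul_one]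
    rwa [mul_add, ← mul_assoc, mul_sub, mul_one, hQP, sub_self, zero_mul, add_zero] at h1
  have hQeq : Q' = Q := by
    rw [← hQQ]
    ext x z
    rw [mul_apply, Finset.sum_congr rfl fun y _ => by rw [hQ y x z], ← Finset.sum_mul,
      sum_row_of_mem_rowStochastic (hd'.mem_rowStochastic hP'), one_mul]
  -- Now `Q d ≤ d ≤ Q d`, so `d` is fixed by `P'`. The gap vanishes on transient states as well,
  -- which gives agreement everywhere.
  rw [hQeq] at hd1
  have hdc : Q *ᵥ d = d := le_antisymm hd1 hd2
  have hPd : M.transMatrix π' *ᵥ d = d := by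
    rw [← hdc, mulVec_mulVec, ← hQeq, hd'.mul_eq]
  funext s
  exact htight s (by rw [hPd, sub_self, Pi.zero_apply])

end

end MDP

/-! ### Gaussian perturbations and conclusion. -/

/-- A nonzero linear functional of independent standard Gaussians, shifted by a constant, almost
surely does not vanish. -/
lemma ae_linearMap_gaussian_ne {ι Ω : Type*} [Fintype ι] [DecidableEq ι] [MeasurableSpace Ω]
    {μ : Measure Ω} [IsProbabilityMeasure μ] {U : ι → Ω → ℝ}
    (hU_law : ∀ i, HasLaw (U i) (gaussianReal 0 1) μ) (hU_indep : iIndepFun U μ)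
    (L : (ι → ℝ) →ₗ[ℝ] ℝ) {i₀ : ι} (hL : L (Pi.single i₀ 1) ≠ 0) (r : ι → ℝ) :
    ∀ᵐ ω ∂μ, L (r + fun i => U i ω) ≠ 0 := by
  set c : ι → ℝ := fun i => L (Pi.single i 1) with hc
  set X : ι → Ω → ℝ := fun i => c i • U i with hX
  have hlaw : ∀ i, HasGaussianLaw (X i) μ := fun i => (hU_law i).hasGaussianLaw.smul (c i)
  have hind : iIndepFun X μ :=
    hU_indep.comp (fun i x => c i • x) fun i => measurable_const_smul (c i)
  have hsum := hind.hasGaussianLaw_sum hlaw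
  have hvar : variance (∑ i, X i) μ = ∑ i, c i ^ 2 := by
    rw [IndepFun.variance_sum (fun i _ => (hlaw i).memLp_two)
      fun i _ j _ hij => hind.indepFun hij]
    refine Finset.sum_congr rfl fun i _ => ?_
    rw [hX, variance_smul, (hU_law i).variance_eq, variance_id_gaussianReal]
    simp
  have hpos : 0 < variance (∑ i, X i) μ := by
    rw [hvar]
    exact Finset.sum_pos' (fun i _ => sq_nonneg _) ⟨i₀, Finset.mem_univ _, by positivity⟩
  have hnull : μ.map (∑ i, X i) {-L r} = 0 := by
    rw [hsum.map_eq_gaussianReal]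
    have := nullSingletonClass_gaussianReal (μ := μ[∑ i, X i])
      (Real.toNNReal_pos.2 hpos).ne'
    exact measure_singleton _
  rw [Measure.map_apply_of_aemeasurable hsum.aemeasurable (measurableSet_singleton _)] at hnull
  refine measure_mono_null (fun ω hω => ?_) hnull
  have h0 : L (r + fun i => U i ω) = 0 := not_not.1 hω
  rw [map_add, LinearMap.pi_apply_eq_sum_univ L (fun i => U i ω)] at h0
  have h1 : (∑ i, X i) ω = ∑ i, U i ω • L (fun j => if i = j then 1 else 0) := by
    rw [Finset.sum_apply]
    refine Finset.sum_congr rfl fun i _ => ?_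
    have : (fun j => if i = j then (1 : ℝ) else 0) = Pi.single i 1 := by
      ext j
      simp [Pi.single_apply, eq_comm]
    rw [this, hX]
    simp [hc, mul_comm]
  rw [Set.mem_preimage, Set.mem_singleton_iff, h1]
  linarith

open Matrix in
theorem mainTheorem9 {S : Type*} {A : S → Type*} [Fintype S] [DecidableEq S] [Nonempty S]
    [∀ s, Fintype (A s)] [∀ s, Nonempty (A s)]
    (M : MDP S A) (hM : M.Communicating)
    {Ω : Type*} [MeasurableSpace Ω] (μ : Measure Ω) [IsProbabilityMeasure μ]
    (U : ((s : S) × A s) → Ω → ℝ)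
    (hU_law : ∀ z, HasLaw (U z) (gaussianReal 0 1) μ)
    (hU_indep : iIndepFun U μ) :
    ∀ᵐ ω ∂μ, (M.addReward fun z => U z ω).NonDegenerate := by
  classical
  have hacc := hM.exists_accessible
  choose Q H K hd using fun π : MDP.Policy S A =>
    exists_isDeviation (M.transMatrix_mem_rowStochastic π)
  let R : MDP.Policy S A → (((s : S) × A s) → ℝ) →ₗ[ℝ] (S → ℝ) := fun π =>
    LinearMap.pi fun x => LinearMap.proj ⟨x, π x⟩
  have hstrict : ∀ᵐ ω ∂μ, ∀ (π : MDP.Policy S A) (s : S) (a : A s), a ≠ π s →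
      (Q π *ᵥ R π (M.r + fun z => U z ω)) s + (H π *ᵥ R π (M.r + fun z => U z ω)) s ≠
        (M.r + fun z => U z ω) ⟨s, a⟩ +
          ∑ x, M.p ⟨s, a⟩ x * (H π *ᵥ R π (M.r + fun z => U z ω)) x := by
    simp only [ae_all_iff]
    intro π s a ha
    let L : (((s : S) × A s) → ℝ) →ₗ[ℝ] ℝ :=
      LinearMap.proj s ∘ₗ (Q π).mulVecLin ∘ₗ R π + LinearMap.proj s ∘ₗ (H π).mulVecLin ∘ₗ R π
        - (LinearMap.proj ⟨s, a⟩
          + ∑ x, M.p ⟨s, a⟩ x • (LinearMap.proj x ∘ₗ (H π).mulVecLin ∘ₗ R π))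
    -- The policy never collects the reward of `⟨s, a⟩`, so only the explicit reward term remains
    -- and the coefficient is `-1`.
    have hL : L (Pi.single ⟨s, a⟩ 1) ≠ 0 := by
      have hR : R π (Pi.single ⟨s, a⟩ 1) = 0 := by
        funext x
        refine Pi.single_eq_of_ne (fun h => ha ?_) _
        obtain ⟨rfl, h2⟩ := Sigma.mk.inj_iff.1 h
        exact (eq_of_heq h2).symm
      simp [L, hR]
    filter_upwards [ae_linearMap_gaussian_ne hU_law hU_indep L hL M.r] with ω hω heq
    refine hω ?_
    simp only [L, LinearMap.sub_apply, LinearMap.add_apply, LinearMap.comp_apply,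
      LinearMap.proj_apply, mulVecLin_apply, LinearMap.sum_apply, LinearMap.smul_apply,
      smul_eq_mul]
    exact sub_eq_zero.2 heq
  have hrows : ∀ᵐ ω ∂μ, ∀ (π : MDP.Policy S A) (x y z : S), Q π x z ≠ Q π y z →
      (Q π *ᵥ R π (M.r + fun z => U z ω)) x ≠ (Q π *ᵥ R π (M.r + fun z => U z ω)) y := by
    simp only [ae_all_iff]
    intro π x y z hz
    let L : (((s : S) × A s) → ℝ) →ₗ[ℝ] ℝ :=
      LinearMap.proj x ∘ₗ (Q π).mulVecLin ∘ₗ R π - LinearMap.proj y ∘ₗ (Q π).mulVecLin ∘ₗ R π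
    -- This coefficient is `Q π x z - Q π y z`.
    have hL : L (Pi.single ⟨z, π z⟩ 1) ≠ 0 := by
      have hR : R π (Pi.single ⟨z, π z⟩ 1) = Pi.single z 1 := by
        funext w
        rcases eq_or_ne w z with rfl | hw
        · simp [R]
        · rw [Pi.single_eq_of_ne hw]
          exact Pi.single_eq_of_ne (fun h => hw (Sigma.mk.inj_iff.1 h).1) _
      simpa [L, hR, sub_eq_zero] using hz
    filter_upwards [ae_linearMap_gaussian_ne hU_law hU_indep L hL M.r] with ω hω heq
    exact hω (sub_eq_zero.2 heq)
  filter_upwards [hstrict, hrows] with ω hs hr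
  set M' := M.addReward fun z => U z ω
  have hacc' : ∀ x y, ∃ π : MDP.Policy S A, M'.Accessible π x y := hacc
  have hd' : ∀ π, IsDeviation (M'.transMatrix π) (Q π) (H π) (K π) := hd
  have hQ : ∀ π, M'.IsBellmanOptimal π → ∀ x y z, Q π x z = Q π y z := by
    intro π hπ x y z
    by_contra hne
    rw [M'.isBellmanOptimal_iff π (hd' π)] at hπ
    exact hr π x y z hne (MDP.eq_of_superharmonic hacc' hπ.1 x y)
  obtain ⟨π, hπ⟩ := MDP.exists_isBellmanOptimal hacc'
  exact ⟨π, hπ, fun π' hπ' => MDP.isBellmanOptimal_unique hacc' (hd' π) (hd' π') (hs π) (hQ π hπ)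
    hπ hπ', M'.isUnichain_of_rows_eq π (hd' π) (hQ π hπ)⟩
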